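/- All logarithms are to base $2$. **Channel.** In each of $n$ channel uses a fresh pair of non-negative real gains $(H_T,H_E)$ is drawn i.i.d., with $H_T$ independent of $H_E$ and $\mathbb E[H_E^2]<\infty$; on input $X_k$ the eavesdropper of the fast-fading wiretap channel receives $Z_k=H_{E,k}X_k+U_{E,k}$ with i.i.d. noise $U_{E,k}\sim N(0,\sigma_E^2)$, $\sigma_E^2>0$, independent of everything else. The eavesdropper also knows $(H_T^n,H_E^n)$, and the transmitter knows $(H_{T,k},H_{E,k})$ at time $k$ (full CSIT). **Multiplexing.** For $d\in\mathbb N$ take $0\le h_{T,1}<\dots<h_{T,d+1}$ and $0\le h_{E,1}<\dots<h_{E,d+1}$. They define $d^2$ parallel channels, one for each cell $[h_{T,i},h_{T,i+1})\times[h_{E,j},h_{E,j+1})$. Let $p_{ij}$ be the probability that $(H_T,H_E)$ lies in cell $(i,j)$, let $\gamma_{ij}\ge 0$ be transmit powers with $\sum_{i,j}p_{ij}\gamma_{ij}\le P$, and let $\gamma_d(h_T,h_E)=\gamma_{ij}$ on cell $(i,j)$ and $0$ outside all cells. For block length $n$, let $n_{ij}\in\mathbb N$ with $n_{ij}=p_{ij}n-o(n)$,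 and let $\mathcal C^{ij}_{n}\subset\mathbb R^{n_{ij}}$ be a finite nonempty codebook with $\|x\|^2\le n_{ij}\gamma_{ij}$ for all $x\in\mathcal C^{ij}_{n}$. The input $X^n$ is a tuple of codewords, one from each $\mathcal C^{ij}_n$, uniformly distributed on $\prod_{i,j}\mathcal C^{ij}_n$ and independent of the gains. At each time at which the gains lie in cell $(i,j)$ the next symbol of the codeword for $(i,j)$ is sent; nothing (the symbol $0$) is sent if that codeword has been used up or if the gains lie in no cell. **Smooth max-information.** For $M$ uniform on a finite set and an observation $Z^*$ with transition density $\omega(z|m)$ with respect to a reference measure $\mu$, a set $\mathcal T$ is $(1-\epsilon)$-typical if $\mathbb P[(M,Z^*)\in\mathcal T\mid M=m]\ge 1-\epsilon$ for all $m$. With $\omega_{\mathcal T}(m|z)=\omega(m|z)\mathbf 1((m,z)\in\mathcal T)$ put $$I_\infty^{\mathcal T}(M;Z^*)=\log|M|+\log\int\omega(z)\max_m\omega_{\mathcal T}(m|z)\,\mu(dz),\qquad I_\infty^\epsilon=\inf_{\mathcal T}I_\infty^{\mathcal T},$$ where $|M|$ is the number of values of $M$ and the infimum is over all $(1-\epsilon)$-typical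 sets. **Theorem.** Let $\gamma:\mathbb R_+^2\to\mathbb R_+$ be measurable. For each $d$ let a demultiplexing into $d^2$ cells as above be given (with the same $P$ for all $d$) such that, as $d\to\infty$, the lengths of the intervals $[h_{T,i},h_{T,i+1})$ and $[h_{E,j},h_{E,j+1})$ tend to $0$ uniformly, the probability that $(H_T,H_E)$ lies in no cell tends to $0$, and $\gamma_d(H_T,H_E)\to\gamma(H_T,H_E)$ in probability. Then the per-symbol smooth max-information is asymptotically at most $\frac12\mathbb E\big[\log(1+\gamma(H_T,H_E)H_E^2/\sigma_E^2)\big]$, with $\epsilon$ exponentially decreasing in $n$: for every $\eta>0$ and all sufficiently large $d$ there is $a>0$ such that, for all choices of the codebooks, with $\epsilon_n=e^{-an}$, $$\limsup_{n\to\infty}\frac1n I_\infty^{\epsilon_n}(X^n;Z^n,H_T^n,H_E^n)\le\frac12\,\mathbb E_{H_T,H_E}\!\left[\log\!\left(1+\frac{\gamma(H_T,H_E)\,H_E^2}{\sigma_E^2}\right)\right]+\eta .$$ -/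

import Mathlib

open MeasureTheory ProbabilityTheory Filter Topology Asymptotics
open scoped NNReal ENNReal

noncomputable section

/-! ### Smooth max-information

`M` is a finite input alphabet with the uniform distribution, `Z` an output space with a reference
measure `μ`, and `ω m z` the transition density `ω(z|m)` with respect to `μ`. All quantities take
values in the extended reals, and logarithms are to base `2`. -/

/-- The logarithm to base `2`, with `log2 0 = -∞` and `log2 ∞ = ∞`. -/
def log2 (x : ℝ≥0∞) : EReal := ENNReal.log x / ((Real.log 2 : ℝ) : EReal)

section MaxInformation

variable {M Z : Type*} [Fintype M] [MeasurableSpace Z]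

/-- The joint density `ω(m, z) = ω(m) ω(z|m)` for the uniform input `ω(m) = 1 / |M|`. -/
def jointDensity (ω : M → Z → ℝ≥0∞) (m : M) (z : Z) : ℝ≥0∞ :=
  (Fintype.card M : ℝ≥0∞)⁻¹ * ω m z

/-- The density `ω(z)` of the output. -/
def outputDensity (ω : M → Z → ℝ≥0∞) (z : Z) : ℝ≥0∞ := ∑ m, jointDensity ω m z

/-- The conditional probability `ω(m|z)` of the input given the output. -/
def inputPosterior (ω : M → Z → ℝ≥0∞) (m : M) (z : Z) : ℝ≥0∞ :=
  jointDensity ω m z / outputDensity ω z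

open Classical in
/-- The restriction `ω_T(m|z) = ω(m|z) 1((m, z) ∈ T)`. -/
def inputPosteriorOn (ω : M → Z → ℝ≥0∞) (T : Set (M × Z)) (m : M) (z : Z) : ℝ≥0∞ :=
  if (m, z) ∈ T then inputPosterior ω m z else 0

/-- The conditional min-entropy restricted to `T`:
`H_∞^T(M|Z) = - log ∫ ω(z) max_m ω_T(m|z) μ(dz)`. -/
def condMinEntropyOn (μ : Measure Z) (ω : M → Z → ℝ≥0∞) (T : Set (M × Z)) : EReal :=
  -log2 (∫⁻ z, outputDensity ω z * ⨆ m, inputPosteriorOn ω T m z ∂μ)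

/-- The max-information evaluated on `T`: `I_∞^T(M; Z) = log |M| - H_∞^T(M|Z)`. -/
def maxInfoOn (μ : Measure Z) (ω : M → Z → ℝ≥0∞) (T : Set (M × Z)) : EReal :=
  log2 (Fintype.card M) - condMinEntropyOn μ ω T

/-- `T` is a `(1 - ε)`-typical set: `P[(M, Z) ∈ T | M = m] ≥ 1 - ε` for every `m`. -/
def IsTypical (μ : Measure Z) (ω : M → Z → ℝ≥0∞) (ε : ℝ) (T : Set (M × Z)) : Prop :=
  ∀ m, MeasurableSet {z | (m, z) ∈ T} ∧
    ENNReal.ofReal (1 - ε) ≤ ∫⁻ z in {z | (m, z) ∈ T}, ω m z ∂μ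

/-- The `ε`-smooth max-information `I_∞^ε(M; Z)`: the infimum of `I_∞^T(M; Z)` over all
`(1 - ε)`-typical sets `T`. -/
def smoothMaxInfo (μ : Measure Z) (ω : M → Z → ℝ≥0∞) (ε : ℝ) : EReal :=
  ⨅ (T : Set (M × Z)) (_ : IsTypical μ ω ε T), maxInfoOn μ ω T

end MaxInformation

/-! ### The fast-fading wiretap channel -/

/-- The (real) fast-fading wiretap channel, as far as the eavesdropper is concerned. In each channel
use the pair of gains `(H_T, H_E)` is drawn afresh, `H_T ∼ lawT` and `H_E ∼ lawE` being independent,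
and on input `x` the eavesdropper receives `H_E x + U_E` with `U_E ∼ N(0, noiseE)`, so that
`noiseE` is `σ_E²`. -/
structure FadingWiretapChannel where
  lawT : Measure ℝ≥0
  lawE : Measure ℝ≥0
  isProb_lawT : IsProbabilityMeasure lawT
  isProb_lawE : IsProbabilityMeasure lawE
  integrable_sq_gainE : Integrable (fun h : ℝ≥0 => (h : ℝ) ^ 2) lawE
  noiseE : ℝ≥0
  noiseE_pos : 0 < noiseE

namespace FadingWiretapChannel

/-- The joint law of the pair of gains `(H_T, H_E)` in one channel use. -/
def gainLaw (W : FadingWiretapChannel) : Measure (ℝ≥0 × ℝ≥0) := W.lawT.prod W.lawE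

/-- The reference measure for the eavesdropper's observation `(Z^n, (H_T^n, H_E^n))` over `n` uses:
Lebesgue measure for `Z^n` and the law of the i.i.d. gains for `(H_T^n, H_E^n)`. -/
def refMeasure (W : FadingWiretapChannel) (n : ℕ) :
    Measure ((Fin n → ℝ) × (Fin n → ℝ≥0 × ℝ≥0)) :=
  volume.prod (Measure.pi fun _ => W.gainLaw)

end FadingWiretapChannel

/-! ### Demultiplexing under full CSIT -/

/-- The cell `[a_i, a_{i+1}) × [b_j, b_{j+1})` of gain pairs, for `c = (i, j)`. -/
def gridCell {d : ℕ} (a b : Fin (d + 1) → ℝ≥0) (c : Fin d × Fin d) : Set (ℝ≥0 × ℝ≥0) :=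
  Set.Ico (a c.1.castSucc) (a c.1.succ) ×ˢ Set.Ico (b c.2.castSucc) (b c.2.succ)

/-- A demultiplexing of the channel into `d²` parallel channels, one for each cell, under the
average power constraint `P`. The codeword length planned for cell `c` in a block of `n` channel
uses is `len n c = p_c n - ε_c(n)` with `p_c` the probability of the cell and `ε_c(n) = o(n)`. -/
structure Demultiplexing (W : FadingWiretapChannel) (P : ℝ) (d : ℕ) where
  endT : Fin (d + 1) → ℝ≥0
  endE : Fin (d + 1) → ℝ≥0
  strictMono_endT : StrictMono endT
  strictMono_endE : StrictMono endE
  power : Fin d × Fin d → ℝ≥0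
  power_le : ∑ c, W.gainLaw.real (gridCell endT endE c) * (power c : ℝ) ≤ P
  len : ℕ → Fin d × Fin d → ℕ
  len_isLittleO : ∀ c, (fun n : ℕ => W.gainLaw.real (gridCell endT endE c) * (n : ℝ) - (len n c : ℝ))
    =o[atTop] fun n : ℕ => (n : ℝ)

namespace Demultiplexing

variable {W : FadingWiretapChannel} {P : ℝ} {d : ℕ}

/-- The set of gain pairs assigned to the parallel channel `c`. -/
def cell (D : Demultiplexing W P d) (c : Fin d × Fin d) : Set (ℝ≥0 × ℝ≥0) :=
  gridCell D.endT D.endE c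

open Classical in
/-- The transmit power as a function of the gains: constant on each cell, zero outside the cells. -/
def alloc (D : Demultiplexing W P d) (h : ℝ≥0 × ℝ≥0) : ℝ≥0 :=
  ∑ c, if h ∈ D.cell c then D.power c else 0

/-- For block length `n`, a finite nonempty codebook for every parallel channel, all of whose
codewords obey the power constraint of that channel. -/
structure Codebooks (D : Demultiplexing W P d) (n : ℕ) where
  words : ∀ c, Finset (Fin (D.len n c) → ℝ)
  words_nonempty : ∀ c, (words c).Nonempty
  words_power : ∀ c, ∀ x ∈ words c, ∑ r, x r ^ 2 ≤ (D.len n c : ℝ) * (D.power c : ℝ)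

/-- The input alphabet of the multiplexed channel: one codeword for every parallel channel. -/
abbrev Codebooks.Input {D : Demultiplexing W P d} {n : ℕ} (C : D.Codebooks n) : Type :=
  ∀ c, {x : Fin (D.len n c) → ℝ // x ∈ C.words c}

open Classical in
/-- The number of uses of the parallel channel `c` before time `k`. -/
def usesBefore (D : Demultiplexing W P d) {n : ℕ} (c : Fin d × Fin d)
    (h : Fin n → ℝ≥0 × ℝ≥0) (k : Fin n) : ℕ :=
  (Finset.univ.filter fun k' : Fin n => k' < k ∧ h k' ∈ D.cell c).card

open Classical in
/-- The symbol sent at time `k`: if the current gains lie in cell `c`, the next symbol of the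
codeword of the parallel channel `c`; nothing (that is, `0`) if this codeword has been used up or
if the gains lie in no cell. -/
def symbol (D : Demultiplexing W P d) {n : ℕ} (x : ∀ c, Fin (D.len n c) → ℝ)
    (h : Fin n → ℝ≥0 × ℝ≥0) (k : Fin n) : ℝ :=
  ∑ c, if hc : h k ∈ D.cell c ∧ D.usesBefore c h k < D.len n c then
    x c ⟨D.usesBefore c h k, hc.2⟩ else 0

/-- The transition density, with respect to `W.refMeasure n`, from the tuple of codewords to the
eavesdropper's observation `(Z^n, (H_T^n, H_E^n))`; given the gains, `Z_k` are independent with law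
`N(H_{E,k} X_k, σ_E²)`. -/
def eveDensity (D : Demultiplexing W P d) {n : ℕ} (C : D.Codebooks n) (x : C.Input)
    (zh : (Fin n → ℝ) × (Fin n → ℝ≥0 × ℝ≥0)) : ℝ≥0∞ :=
  ∏ k, gaussianPDF (((zh.2 k).2 : ℝ) * D.symbol (fun c => (x c).1) zh.2 k) W.noiseE (zh.1 k)

/-- The `ε`-smooth max-information `I_∞^ε(X^n; Z^n, H_T^n, H_E^n)` of the multiplexing scheme, the
tuple of codewords being uniformly distributed and independent of the gains. -/
def eveMaxInfo (D : Demultiplexing W P d) {n : ℕ} (C : D.Codebooks n) (ε : ℝ) : EReal :=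
  smoothMaxInfo (W.refMeasure n) (D.eveDensity C) ε

end Demultiplexing

end

/-! ### Bounding the smooth max-information by a reference output density -/

/-! If on a typical set the transition density is at most `exp x` times a fixed output density `q`
of mass at most one, then `x` nats bound the smooth max-information, whatever the input alphabet
(`smoothMaxInfo_le`). Here `q` is, given the gains, a product of centred Gaussians of variance `σ² +
e`, where `e` is the largest signal power the eavesdropper can receive in the current cell. The
typical set is where the likelihood ratio is at most `exp (n (peakRate + η))`.

The conditional probability of leaving this set is bounded by Chernoff's method
(`setLIntegral_eveDensity_le`). A Gaussian tilted by the `s`-th power of its ratio to `q` is again a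
Gaussian, times an explicit factor. The signal enters that factor through a weighted sum of squares.
Each codeword symbol is sent at most once, so the power constraints bound this sum for every
realisation of the gains, and no typicality of the gains is needed. Since the lengths are `p_c n -
o(n)`, the resulting positive term cancels, to first order in `s`, the negative mean of the
remaining gain term. What is left is `s n peakRate + O(s² n)`, so a small fixed `s` gives
exponential decay.

It remains to compare `peakRate` with the capacity for `γ` (`eventually_peakRate_le`). Convergence
in probability does not make the powers uniformly integrable, but the logarithm grows more slowly
than any linear function. The error therefore has small multiples of `γ`, `γ_d` and `(H_E + 1)²`,
whose means are bounded independently of `d`, and a large constant that matters only on an event of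
vanishing probability. -/

lemma log2_mono : Monotone log2 := fun _ _ h =>
  EReal.div_le_div_right_of_nonneg (by exact_mod_cast (Real.log_pos one_lt_two).le)
    (ENNReal.log_monotone h)

lemma log2_ofReal_exp (x : ℝ) : log2 (ENNReal.ofReal (Real.exp x)) = ((x / Real.log 2 : ℝ) : EReal) := by
  rw [log2, ENNReal.log_ofReal_of_pos (Real.exp_pos x), Real.log_exp, EReal.coe_div]

/-- If the transition density is at most `exp x` times a subprobability density `q` on a typical
set, then the smooth max-information is at most `x`, measured in bits. -/
lemma smoothMaxInfo_le {M Z : Type*} [Fintype M] [Nonempty M] [MeasurableSpace Z] {μ : Measure Z}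
    {ω : M → Z → ℝ≥0∞} {ε x : ℝ} {T : Set (M × Z)} (hT : IsTypical μ ω ε T) (q : Z → ℝ≥0∞)
    (hω : ∀ m z, (m, z) ∈ T → ω m z ≤ ENNReal.ofReal (Real.exp x) * q z)
    (hq : ∫⁻ z, q z ∂μ ≤ 1) :
    smoothMaxInfo μ ω ε ≤ ((x / Real.log 2 : ℝ) : EReal) := by
  refine (iInf₂_le T hT).trans ?_
  have hcard : (0 : ℝ) < Fintype.card M := by exact_mod_cast Fintype.card_pos
  have hL : ∫⁻ z, outputDensity ω z * ⨆ m, inputPosteriorOn ω T m z ∂μ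
      ≤ ENNReal.ofReal (Real.exp (x - Real.log (Fintype.card M))) := by
    have hpt : ∀ z, outputDensity ω z * ⨆ m, inputPosteriorOn ω T m z
        ≤ ENNReal.ofReal (Real.exp (x - Real.log (Fintype.card M))) * q z := by
      intro z
      rw [ENNReal.mul_iSup]
      refine iSup_le fun m => ?_
      unfold inputPosteriorOn
      split_ifs with h
      · refine (ENNReal.mul_div_le).trans ?_
        rw [jointDensity, Real.exp_sub, Real.exp_log hcard, div_eq_inv_mul,
          ENNReal.ofReal_mul (by positivity), ENNReal.ofReal_inv_of_pos hcard,
          ENNReal.ofReal_natCast, mul_assoc]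
        gcongr
        exact hω m z h
      · simp
    calc _ ≤ ∫⁻ z, ENNReal.ofReal (Real.exp (x - Real.log (Fintype.card M))) * q z ∂μ :=
          lintegral_mono hpt
      _ = ENNReal.ofReal (Real.exp (x - Real.log (Fintype.card M))) * ∫⁻ z, q z ∂μ :=
          lintegral_const_mul' _ _ ENNReal.ofReal_ne_top
      _ ≤ _ := mul_le_of_le_one_right' hq
  have hc : log2 (Fintype.card M) = ((Real.log (Fintype.card M) / Real.log 2 : ℝ) : EReal) := by
    rw [← log2_ofReal_exp, Real.exp_log hcard, ENNReal.ofReal_natCast]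
  unfold maxInfoOn condMinEntropyOn
  rw [sub_eq_add_neg, neg_neg, hc]
  refine (add_le_add_right ((log2_mono hL).trans_eq (log2_ofReal_exp _)) _).trans_eq ?_
  rw [← EReal.coe_add]
  congr 1
  ring

/-- A set is typical as soon as its complement has small conditional probability. -/
lemma isTypical_of_compl {M Z : Type*} [Fintype M] [MeasurableSpace Z] {μ : Measure Z}
    {ω : M → Z → ℝ≥0∞} {ε : ℝ} (hε : 0 ≤ ε) {T : Set (M × Z)}
    (hTm : ∀ m, MeasurableSet {z | (m, z) ∈ T})
    (hω : ∀ m, ∫⁻ z, ω m z ∂μ = 1)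
    (hT : ∀ m, ∫⁻ z in {z | (m, z) ∈ T}ᶜ, ω m z ∂μ ≤ ENNReal.ofReal ε) :
    IsTypical μ ω ε T := by
  refine fun m => ⟨hTm m, ?_⟩
  have hadd := lintegral_add_compl (μ := μ) (ω m) (hTm m)
  rw [hω m] at hadd
  rw [ENNReal.ofReal_sub _ hε, ENNReal.ofReal_one, tsub_le_iff_right, ← hadd]
  gcongr
  exact hT m

/-! ### Gaussian densities -/

/-- Tilting a Gaussian density of variance `σ` by the power `s` of its ratio to a centred Gaussian
density of larger variance `σ + e` gives a multiple of a Gaussian density. -/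
lemma gaussianPDFReal_mul_rpow_div {σ : ℝ≥0} (hσ : 0 < σ) (e : ℝ≥0) (s : ℝ≥0) (m z : ℝ) :
    gaussianPDFReal m σ z * (gaussianPDFReal m σ z / gaussianPDFReal 0 (σ + e) z) ^ (s : ℝ)
      = Real.exp (s / 2 * Real.log (1 + e / σ) - 1 / 2 * Real.log (1 + s * e / (σ + e))
          + s * (1 + s) * m ^ 2 / (2 * (σ + e + s * e)))
        * gaussianPDFReal ((1 + s) * m * (σ + e) / (σ + e + s * e))
            (σ * (σ + e) / (σ + e + s * e)) z := by
  have hlog : ∀ (a : ℝ) (v : ℝ≥0), 0 < v → gaussianPDFReal a v z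
      = Real.exp (-(1 / 2) * (Real.log (2 * Real.pi) + Real.log v) - (z - a) ^ 2 / (2 * v)) := by
    intro a v hv
    have hv' : (0 : ℝ) < v := hv
    rw [gaussianPDFReal, ← Real.log_mul (by positivity) (by positivity), sub_eq_add_neg _ (_ / _),
      Real.exp_add, mul_comm (-(1 / 2 : ℝ)), Real.exp_mul, Real.exp_log (by positivity),
      Real.rpow_neg (by positivity), Real.sqrt_eq_rpow, neg_div]
  have hσ' : (0 : ℝ) < σ := hσ
  rw [hlog _ _ hσ, hlog _ _ (by positivity), hlog _ _ (by positivity), ← Real.exp_sub,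
    ← Real.exp_mul, ← Real.exp_add, ← Real.exp_add]
  have h1 : (1 + e / σ : ℝ) = (σ + e) / σ := by field_simp
  have h2 : (1 + s * e / (σ + e) : ℝ) = (σ + e + s * e) / (σ + e) := by field_simp
  have hv : (0 : ℝ) < σ + e := by positivity
  have hw : (0 : ℝ) < σ + e + s * e := by positivity
  push_cast
  rw [h1, h2, Real.log_div hv.ne' hσ'.ne', Real.log_div hw.ne' hv.ne', Real.log_div (by positivity) hw.ne',
    Real.log_mul hσ'.ne' hv.ne']
  congr 1
  -- Completing the square in `z`; the logarithmic normalising terms already match.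
  have key : -(z - m) ^ 2 / (2 * σ) + (-(z - m) ^ 2 / (2 * σ) + z ^ 2 / (2 * (σ + e))) * s
      = s * (1 + s) * m ^ 2 / (2 * (σ + e + s * e))
        - (z - (1 + s) * m * (σ + e) / (σ + e + s * e)) ^ 2 / (2 * (σ * (σ + e) / (σ + e + s * e))) := by
    field_simp
    ring
  linear_combination key

lemma measurable_gaussianPDF_comp {α : Type*} [MeasurableSpace α] {m z : α → ℝ} {v : α → ℝ≥0}
    (hm : Measurable m) (hv : Measurable v) (hz : Measurable z) :
    Measurable fun a => gaussianPDF (m a) (v a) (z a) :=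
  measurable_uncurry_gaussianPDF.comp (hm.prodMk (hv.prodMk hz))

lemma lintegral_pi_prod_ofReal {ι E : Type*} [Fintype ι] [MeasurableSpace E] {μ : Measure E}
    [SigmaFinite μ] {f : ι → E → ℝ} (hf : ∀ i x, 0 ≤ f i x) (hfi : ∀ i, Integrable (f i) μ) :
    ∫⁻ x : ι → E, ∏ i, ENNReal.ofReal (f i (x i)) ∂(Measure.pi fun _ => μ)
      = ∏ i, ENNReal.ofReal (∫ x, f i x ∂μ) := by
  simp_rw [← ENNReal.ofReal_prod_of_nonneg fun i _ => hf i _]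
  rw [← ofReal_integral_eq_lintegral_ofReal (Integrable.fintype_prod hfi)
      (ae_of_all _ fun x => Finset.prod_nonneg fun i _ => hf i _),
    integral_fintype_prod_eq_prod, ENNReal.ofReal_prod_of_nonneg fun i _ => integral_nonneg (hf i)]

lemma lintegral_prod_gaussianPDF {n : ℕ} (m : Fin n → ℝ) {v : Fin n → ℝ≥0} (hv : ∀ k, v k ≠ 0) :
    ∫⁻ z : Fin n → ℝ, ∏ k, gaussianPDF (m k) (v k) (z k) = 1 := by
  simp only [gaussianPDF]
  rw [volume_pi, lintegral_pi_prod_ofReal (f := fun k => gaussianPDFReal (m k) (v k))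
    (fun _ _ => gaussianPDFReal_nonneg _ _ _) fun _ => integrable_gaussianPDFReal _ _]
  simp [integral_gaussianPDFReal_eq_one _ (hv _)]

/-- Chernoff's pointwise bound for products of likelihood ratios. -/
lemma prod_le_of_exp_mul_prod_lt {ι : Type*} [Fintype ι] {g q : ι → ℝ} (hg : ∀ i, 0 < g i)
    (hq : ∀ i, 0 < q i) {s t : ℝ} (hs : 0 ≤ s) (h : Real.exp t * ∏ i, q i < ∏ i, g i) :
    ∏ i, g i ≤ Real.exp (-(s * t)) * ∏ i, g i * (g i / q i) ^ s := by
  have hQ : 0 < ∏ i, q i := Finset.prod_pos fun i _ => hq i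
  have hG : 0 < ∏ i, g i := Finset.prod_pos fun i _ => hg i
  rw [Finset.prod_mul_distrib, Real.finsetProd_rpow _ _ fun i _ => (div_pos (hg i) (hq i)).le,
    Finset.prod_div_distrib, mul_left_comm]
  refine le_mul_of_one_le_right hG.le ?_
  have h1 : Real.exp t ≤ (∏ i, g i) / ∏ i, q i := ((lt_div_iff₀ hQ).mpr h).le
  calc (1 : ℝ) = Real.exp (-(s * t)) * Real.exp t ^ s := by
        rw [← Real.exp_mul, ← Real.exp_add]; simp [mul_comm]
    _ ≤ _ := by gcongr

/-! ### The cells and the transmitted symbols -/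

namespace Demultiplexing

variable {W : FadingWiretapChannel} {P : ℝ} {d : ℕ}

lemma index_eq_of_mem_Ico {a : Fin (d + 1) → ℝ≥0} (ha : StrictMono a) {i j : Fin d} {x : ℝ≥0}
    (hi : x ∈ Set.Ico (a i.castSucc) (a i.succ)) (hj : x ∈ Set.Ico (a j.castSucc) (a j.succ)) :
    i = j := by
  by_contra hne
  rcases lt_or_gt_of_ne hne with h | h
  · exact (hi.2.trans_le ((ha.monotone (Fin.succ_le_castSucc_iff.mpr h)).trans hj.1)).false
  · exact (hj.2.trans_le ((ha.monotone (Fin.succ_le_castSucc_iff.mpr h)).trans hi.1)).false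

lemma eq_of_mem_cell (D : Demultiplexing W P d) {c c' : Fin d × Fin d} {h : ℝ≥0 × ℝ≥0}
    (hc : h ∈ D.cell c) (hc' : h ∈ D.cell c') : c = c' :=
  Prod.ext (index_eq_of_mem_Ico D.strictMono_endT hc.1 hc'.1)
    (index_eq_of_mem_Ico D.strictMono_endE hc.2 hc'.2)

lemma measurableSet_cell (D : Demultiplexing W P d) (c : Fin d × Fin d) :
    MeasurableSet (D.cell c) :=
  measurableSet_Ico.prod measurableSet_Ico

open Classical in
/-- The function with value `f c` on the cell `c` and `0` outside all cells. -/
noncomputable def onCells (D : Demultiplexing W P d) (f : Fin d × Fin d → ℝ≥0) (h : ℝ≥0 × ℝ≥0) : ℝ≥0 :=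
  ∑ c, if h ∈ D.cell c then f c else 0

lemma onCells_of_mem (D : Demultiplexing W P d) (f : Fin d × Fin d → ℝ≥0) {c : Fin d × Fin d}
    {h : ℝ≥0 × ℝ≥0} (hc : h ∈ D.cell c) : D.onCells f h = f c := by
  classical
  rw [onCells, Finset.sum_eq_single c, if_pos hc]
  · exact fun c' _ hne => if_neg fun hc' => hne (D.eq_of_mem_cell hc' hc)
  · simp

lemma onCells_of_forall_notMem (D : Demultiplexing W P d) (f : Fin d × Fin d → ℝ≥0)
    {h : ℝ≥0 × ℝ≥0} (hc : ∀ c, h ∉ D.cell c) : D.onCells f h = 0 := by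
  classical
  simp [onCells, hc]

lemma alloc_eq_onCells (D : Demultiplexing W P d) : D.alloc = D.onCells D.power := rfl

lemma measurable_onCells (D : Demultiplexing W P d) (f : Fin d × Fin d → ℝ≥0) :
    Measurable (D.onCells f) := by
  classical
  exact Finset.measurable_sum _ fun c _ =>
    Measurable.ite (D.measurableSet_cell c) measurable_const measurable_const

lemma onCells_le (D : Demultiplexing W P d) (f : Fin d × Fin d → ℝ≥0) (h : ℝ≥0 × ℝ≥0) :
    D.onCells f h ≤ ∑ c, f c := by
  classical
  exact Finset.sum_le_sum fun c _ => by split_ifs <;> simp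

lemma coe_onCells (D : Demultiplexing W P d) (f : Fin d × Fin d → ℝ≥0) (h : ℝ≥0 × ℝ≥0) :
    (D.onCells f h : ℝ) = ∑ c, (D.cell c).indicator (fun _ => (f c : ℝ)) h := by
  classical
  rw [onCells, NNReal.coe_sum]
  refine Finset.sum_congr rfl fun c _ => ?_
  by_cases hc : h ∈ D.cell c <;> simp [hc]

lemma integrable_onCells (D : Demultiplexing W P d) (f : Fin d × Fin d → ℝ≥0)
    (μ : Measure (ℝ≥0 × ℝ≥0)) [IsFiniteMeasure μ] :
    Integrable (fun h => (D.onCells f h : ℝ)) μ := by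
  simp_rw [coe_onCells]
  exact integrable_finsetSum _ fun c _ =>
    (integrable_const (f c : ℝ)).indicator (D.measurableSet_cell c)

lemma integral_onCells (D : Demultiplexing W P d) (f : Fin d × Fin d → ℝ≥0)
    (μ : Measure (ℝ≥0 × ℝ≥0)) [IsFiniteMeasure μ] :
    ∫ h, (D.onCells f h : ℝ) ∂μ = ∑ c, μ.real (D.cell c) * (f c : ℝ) := by
  simp_rw [coe_onCells]
  rw [integral_finsetSum _ fun c _ =>
    (integrable_const (f c : ℝ)).indicator (D.measurableSet_cell c)]
  exact Finset.sum_congr rfl fun c _ => by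
    rw [integral_indicator_const _ (D.measurableSet_cell c), smul_eq_mul]

/-- Before two different uses of a parallel channel it has been used a different number of times. -/
lemma usesBefore_lt (D : Demultiplexing W P d) {n : ℕ} {c : Fin d × Fin d}
    {h : Fin n → ℝ≥0 × ℝ≥0} {k k' : Fin n} (hk : h k ∈ D.cell c) (hkk : k < k') :
    D.usesBefore c h k < D.usesBefore c h k' := by
  classical
  refine Finset.card_lt_card (Finset.ssubset_iff_of_subset ?_ |>.mpr ⟨k, ?_, ?_⟩)
  · intro i hi
    simp only [Finset.mem_filter, Finset.mem_univ, true_and] at hi ⊢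
    exact ⟨hi.1.trans hkk, hi.2⟩
  · simp [hk, hkk]
  · simp

-- The cells are disjoint, so at most one summand is nonzero and `f` passes through the sum; `f 0 =
-- 0` covers the times at which nothing is sent. Taking `f = id` gives measurability, and squaring
-- gives the power bound.
open Classical in
lemma symbol_comp (D : Demultiplexing W P d) {n : ℕ} (x : ∀ c, Fin (D.len n c) → ℝ)
    (h : Fin n → ℝ≥0 × ℝ≥0) (k : Fin n) {f : ℝ → ℝ} (hf : f 0 = 0) :
    f (D.symbol x h k)
      = ∑ c, ∑ r, if h k ∈ D.cell c ∧ D.usesBefore c h k = r.1 then f (x c r) else 0 := by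
  unfold symbol
  by_cases hc : ∃ c, h k ∈ D.cell c
  · obtain ⟨c, hc⟩ := hc
    have hne : ∀ c', c' ≠ c → h k ∉ D.cell c' := fun c' hne hc' => hne (D.eq_of_mem_cell hc' hc)
    rw [Finset.sum_eq_single c (fun c' _ h' => by simp [hne c' h']) (by simp),
      Finset.sum_eq_single c (fun c' _ h' => by simp [hne c' h']) (by simp)]
    by_cases hu : D.usesBefore c h k < D.len n c
    · rw [dif_pos ⟨hc, hu⟩, Finset.sum_eq_single ⟨D.usesBefore c h k, hu⟩]
      · simp [hc]
      · exact fun r _ hr => if_neg fun hh => hr (Fin.ext hh.2.symm)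
      · simp
    · rw [dif_neg fun hh => hu hh.2, hf]
      exact (Finset.sum_eq_zero fun r _ => if_neg fun hh : _ ∧ _ => hu (hh.2.trans_lt r.2)).symm
  · push Not at hc
    simp [hc, hf]

lemma measurable_usesBefore (D : Demultiplexing W P d) {n : ℕ} (c : Fin d × Fin d) (k : Fin n) :
    Measurable fun h : Fin n → ℝ≥0 × ℝ≥0 => D.usesBefore c h k := by
  classical
  simp only [usesBefore, Finset.card_filter]
  refine Finset.measurable_sum _ fun k' _ => Measurable.ite ?_ measurable_const measurable_const
  exact (MeasurableSet.const _).inter ((D.measurableSet_cell c).preimage (measurable_pi_apply k'))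

lemma measurable_symbol (D : Demultiplexing W P d) {n : ℕ} (x : ∀ c, Fin (D.len n c) → ℝ)
    (k : Fin n) : Measurable fun h => D.symbol x h k := by
  classical
  have := fun h => D.symbol_comp x h k (f := id) rfl
  simp only [id] at this
  simp_rw [this]
  refine Finset.measurable_sum _ fun c _ => Finset.measurable_sum _ fun r _ =>
    Measurable.ite ?_ measurable_const measurable_const
  exact ((D.measurableSet_cell c).preimage (measurable_pi_apply k)).inter
    (measurableSet_eq_fun (D.measurable_usesBefore c k) measurable_const)

/-- However the gains turn out, no symbol of a codeword is sent more than once. -/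
lemma sum_mul_symbol_sq_le (D : Demultiplexing W P d) {n : ℕ} (x : ∀ c, Fin (D.len n c) → ℝ)
    (h : Fin n → ℝ≥0 × ℝ≥0) {G : ℝ≥0 × ℝ≥0 → ℝ} {g : Fin d × Fin d → ℝ} (hg : ∀ c, 0 ≤ g c)
    (hG : ∀ c, ∀ p ∈ D.cell c, G p ≤ g c) :
    ∑ k, G (h k) * D.symbol x h k ^ 2 ≤ ∑ c, g c * ∑ r, x c r ^ 2 := by
  classical
  have hsq : ∀ k, D.symbol x h k ^ 2 = _ := fun k =>
    D.symbol_comp x h k (f := fun y => y ^ 2) (by simp)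
  calc ∑ k, G (h k) * D.symbol x h k ^ 2
      ≤ ∑ k, ∑ c, ∑ r : Fin (D.len n c),
          if h k ∈ D.cell c ∧ D.usesBefore c h k = r.1 then g c * x c r ^ 2 else 0 := by
        refine Finset.sum_le_sum fun k _ => ?_
        rw [hsq, Finset.mul_sum]
        refine Finset.sum_le_sum fun c _ => ?_
        rw [Finset.mul_sum]
        refine Finset.sum_le_sum fun r _ => ?_
        split_ifs with hc
        · exact mul_le_mul_of_nonneg_right (hG c _ hc.1) (sq_nonneg _)
        · simp
    _ = ∑ c, ∑ r : Fin (D.len n c), ∑ k,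
          if h k ∈ D.cell c ∧ D.usesBefore c h k = r.1 then g c * x c r ^ 2 else 0 := by
        rw [Finset.sum_comm]
        exact Finset.sum_congr rfl fun c _ => Finset.sum_comm
    _ ≤ ∑ c, g c * ∑ r, x c r ^ 2 := by
        refine Finset.sum_le_sum fun c _ => ?_
        rw [Finset.mul_sum]
        refine Finset.sum_le_sum fun r _ => ?_
        rw [← Finset.sum_filter, Finset.sum_const, nsmul_eq_mul]
        refine mul_le_of_le_one_left (mul_nonneg (hg c) (sq_nonneg _)) ?_
        rw [Nat.cast_le_one, Finset.card_le_one]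
        simp only [Finset.mem_filter, Finset.mem_univ, true_and]
        rintro k ⟨hk, hkr⟩ k' ⟨hk', hkr'⟩
        by_contra hne
        rcases lt_or_gt_of_ne hne with hlt | hlt
        · exact absurd (D.usesBefore_lt hk hlt) (by omega)
        · exact absurd (D.usesBefore_lt hk' hlt) (by omega)

end Demultiplexing

/-! ### The probability of an atypical observation -/

instance (W : FadingWiretapChannel) : IsProbabilityMeasure W.lawT := W.isProb_lawT

instance (W : FadingWiretapChannel) : IsProbabilityMeasure W.lawE := W.isProb_lawE

instance (W : FadingWiretapChannel) : IsProbabilityMeasure W.gainLaw := by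
  unfold FadingWiretapChannel.gainLaw; infer_instance

namespace Demultiplexing

variable {W : FadingWiretapChannel} {P : ℝ} {d : ℕ}

/-- The largest signal power received by the eavesdropper when the gains lie in a given cell. -/
noncomputable def cellPeak (D : Demultiplexing W P d) (c : Fin d × Fin d) : ℝ≥0 :=
  D.power c * D.endE c.2.succ ^ 2

/-- The largest received signal power as a function of the gains. -/
noncomputable def peak (D : Demultiplexing W P d) : ℝ≥0 × ℝ≥0 → ℝ≥0 := D.onCells D.cellPeak

/-- The relative signal power `e / (σ² + (1 + s) e)` on a cell. -/
noncomputable def cellRatio (D : Demultiplexing W P d) (s : ℝ≥0) (c : Fin d × Fin d) : ℝ≥0 :=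
  D.cellPeak c / (W.noiseE + D.cellPeak c + s * D.cellPeak c)

/-- The relative signal power as a function of the gains. -/
noncomputable def ratio (D : Demultiplexing W P d) (s : ℝ≥0) : ℝ≥0 × ℝ≥0 → ℝ≥0 :=
  D.onCells (D.cellRatio s)

lemma ratio_eq (D : Demultiplexing W P d) (s : ℝ≥0) (h : ℝ≥0 × ℝ≥0) :
    D.ratio s h = D.peak h / (W.noiseE + D.peak h + s * D.peak h) := by
  by_cases hc : ∃ c, h ∈ D.cell c
  · obtain ⟨c, hc⟩ := hc
    rw [ratio, peak, D.onCells_of_mem _ hc, D.onCells_of_mem _ hc, cellRatio]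
  · push Not at hc
    rw [ratio, peak, D.onCells_of_forall_notMem _ hc, D.onCells_of_forall_notMem _ hc, zero_div]

lemma ratio_le_one (D : Demultiplexing W P d) (s : ℝ≥0) (h : ℝ≥0 × ℝ≥0) : D.ratio s h ≤ 1 := by
  rw [ratio_eq]
  refine div_le_one_of_le₀ ?_ zero_le
  rw [add_assoc]
  exact (le_self_add : _ ≤ D.peak h + s * D.peak h).trans le_add_self

lemma measurable_peak (D : Demultiplexing W P d) : Measurable D.peak := D.measurable_onCells _

lemma measurable_ratio (D : Demultiplexing W P d) (s : ℝ≥0) : Measurable (D.ratio s) :=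
  D.measurable_onCells _

/-- The reference output density: given the gains, centred Gaussians with the largest variances the
eavesdropper can see. -/
noncomputable def refDensity (D : Demultiplexing W P d) {n : ℕ}
    (zh : (Fin n → ℝ) × (Fin n → ℝ≥0 × ℝ≥0)) : ℝ≥0∞ :=
  ∏ k, gaussianPDF 0 (W.noiseE + D.peak (zh.2 k)) (zh.1 k)

lemma measurable_refDensity (D : Demultiplexing W P d) {n : ℕ} :
    Measurable (D.refDensity (n := n)) := by
  refine Finset.measurable_prod _ fun k _ => measurable_gaussianPDF_comp measurable_const ?_ ?_
  · exact measurable_const.add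
      (D.measurable_peak.comp ((measurable_pi_apply k).comp measurable_snd))
  · exact (measurable_pi_apply k).comp measurable_fst

lemma measurable_eveDensity (D : Demultiplexing W P d) {n : ℕ} (C : D.Codebooks n) (x : C.Input) :
    Measurable (D.eveDensity C x) := by
  refine Finset.measurable_prod _ fun k _ =>
    measurable_gaussianPDF_comp ?_ measurable_const ((measurable_pi_apply k).comp measurable_fst)
  refine Measurable.mul ?_ ((D.measurable_symbol _ k).comp measurable_snd)
  exact measurable_subtype_coe.comp
    (measurable_snd.comp ((measurable_pi_apply k).comp measurable_snd))

lemma lintegral_refMeasure {n : ℕ} {f : (Fin n → ℝ) × (Fin n → ℝ≥0 × ℝ≥0) → ℝ≥0∞}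
    (hf : Measurable f) :
    ∫⁻ zh, f zh ∂(W.refMeasure n)
      = ∫⁻ h, (∫⁻ z, f (z, h)) ∂(Measure.pi fun _ => W.gainLaw) :=
  lintegral_prod_symm' f hf

lemma lintegral_refDensity (D : Demultiplexing W P d) (n : ℕ) :
    ∫⁻ zh, D.refDensity zh ∂(W.refMeasure n) = 1 := by
  rw [lintegral_refMeasure D.measurable_refDensity]
  have := fun h : Fin n → ℝ≥0 × ℝ≥0 => lintegral_prod_gaussianPDF (fun _ => 0)
    (v := fun k => W.noiseE + D.peak (h k)) fun k => (add_pos_of_pos_of_nonneg W.noiseE_pos zero_le).ne'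
  simp [refDensity, this]

lemma lintegral_eveDensity (D : Demultiplexing W P d) {n : ℕ} (C : D.Codebooks n) (x : C.Input) :
    ∫⁻ zh, D.eveDensity C x zh ∂(W.refMeasure n) = 1 := by
  rw [lintegral_refMeasure (D.measurable_eveDensity C x)]
  have := fun m : Fin n → ℝ => lintegral_prod_gaussianPDF m
    (v := fun _ => W.noiseE) fun _ => W.noiseE_pos.ne'
  simp [eveDensity, this]

/-- The exponent of the gains in the moment bound for the likelihood ratio. -/
noncomputable def gainExponent (D : Demultiplexing W P d) (s : ℝ≥0) (h : ℝ≥0 × ℝ≥0) : ℝ :=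
  1 / 2 * Real.log (1 + D.peak h / W.noiseE) - 1 / 2 * D.ratio s h

lemma measurable_gainExponent (D : Demultiplexing W P d) (s : ℝ≥0) :
    Measurable (D.gainExponent s) := by
  have h1 := D.measurable_peak
  have h2 := D.measurable_ratio s
  unfold gainExponent
  fun_prop

/-- The exponent of the gains is bounded, uniformly in `s`. -/
lemma exists_abs_gainExponent_le (D : Demultiplexing W P d) :
    ∃ K : ℝ, 1 ≤ K ∧ ∀ s h, |D.gainExponent s h| ≤ K := by
  have hσ : (0 : ℝ) < W.noiseE := W.noiseE_pos
  refine ⟨(∑ c, D.cellPeak c : ℝ≥0) / W.noiseE + 1, by simp; positivity, fun s h => ?_⟩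
  have h1 : (D.ratio s h : ℝ) ≤ 1 := by exact_mod_cast D.ratio_le_one s h
  have h2 : (0 : ℝ) ≤ D.ratio s h := NNReal.coe_nonneg _
  have h3 : 0 ≤ Real.log (1 + D.peak h / W.noiseE) :=
    Real.log_nonneg (le_add_of_nonneg_right (by positivity))
  have h4 : Real.log (1 + D.peak h / W.noiseE) ≤ (∑ c, D.cellPeak c : ℝ≥0) / W.noiseE := by
    have : (D.peak h : ℝ) ≤ (∑ c, D.cellPeak c : ℝ≥0) := by exact_mod_cast D.onCells_le _ h
    have := div_le_div_of_nonneg_right this hσ.le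
    have := Real.log_le_sub_one_of_pos (x := 1 + D.peak h / W.noiseE) (by positivity)
    linarith
  rw [gainExponent, abs_le]
  constructor <;> linarith

lemma integrable_gainExponent (D : Demultiplexing W P d) (s : ℝ≥0) :
    Integrable (D.gainExponent s) W.gainLaw := by
  obtain ⟨K, -, hK⟩ := D.exists_abs_gainExponent_le
  exact Integrable.of_bound (D.measurable_gainExponent s).aestronglyMeasurable K (ae_of_all _ (hK s))

lemma integrable_exp_gainExponent (D : Demultiplexing W P d) (s : ℝ≥0) :
    Integrable (fun h => Real.exp (s * D.gainExponent s h)) W.gainLaw := by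
  obtain ⟨K, -, hK⟩ := D.exists_abs_gainExponent_le
  refine Integrable.of_bound ((D.measurable_gainExponent s).const_mul _).exp.aestronglyMeasurable
    (Real.exp (s * K)) (ae_of_all _ fun h => ?_)
  rw [Real.norm_eq_abs, Real.abs_exp]
  gcongr
  exact (abs_le.mp (hK s h)).2

/-- The contribution of the codewords is controlled by their power constraints. -/
lemma sum_received_sq_le (D : Demultiplexing W P d) {n : ℕ} (C : D.Codebooks n) (x : C.Input)
    (s : ℝ≥0) (h : Fin n → ℝ≥0 × ℝ≥0) :
    ∑ k, (((h k).2 : ℝ) * D.symbol (fun c => (x c).1) h k) ^ 2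
        / (W.noiseE + D.peak (h k) + s * D.peak (h k))
      ≤ ∑ c, (D.cellRatio s c : ℝ) * D.len n c := by
  have hσ : (0 : ℝ) < W.noiseE := W.noiseE_pos
  calc _ = ∑ k, (((h k).2 : ℝ) ^ 2 / (W.noiseE + D.peak (h k) + s * D.peak (h k)))
        * D.symbol (fun c => (x c).1) h k ^ 2 := by
        refine Finset.sum_congr rfl fun k _ => ?_
        ring
    _ ≤ ∑ c, ((D.endE c.2.succ : ℝ) ^ 2 / (W.noiseE + D.cellPeak c + s * D.cellPeak c))
        * ∑ r, (x c).1 r ^ 2 := by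
        refine D.sum_mul_symbol_sq_le _ h (fun c => by positivity)
          (G := fun p => (p.2 : ℝ) ^ 2 / (W.noiseE + D.peak p + s * D.peak p)) fun c p hp => ?_
        have hle : (p.2 : ℝ) ≤ D.endE c.2.succ := by exact_mod_cast hp.2.2.le
        simp only [peak, D.onCells_of_mem _ hp]
        gcongr
    _ ≤ _ := by
        refine Finset.sum_le_sum fun c _ => ?_
        refine (mul_le_mul_of_nonneg_left (C.words_power c _ (x c).2) (by positivity)).trans_eq ?_
        rw [cellRatio, cellPeak]
        push_cast
        ring

/-- Moment bound for the likelihood ratio between the true and the reference density. -/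
lemma setLIntegral_eveDensity_le (D : Demultiplexing W P d) {n : ℕ} (C : D.Codebooks n)
    (x : C.Input) (s : ℝ≥0) (t : ℝ) :
    ∫⁻ zh in {zh | D.eveDensity C x zh ≤ ENNReal.ofReal (Real.exp t) * D.refDensity zh}ᶜ,
        D.eveDensity C x zh ∂(W.refMeasure n)
      ≤ ENNReal.ofReal (Real.exp (-(s * t) + s * (1 + s) / 2 * ∑ c, (D.cellRatio s c : ℝ) * D.len n c)
          * (∫ h, Real.exp (s * D.gainExponent s h) ∂W.gainLaw) ^ n) := by
  set K : ℝ := -(s * t) + s * (1 + s) / 2 * ∑ c, (D.cellRatio s c : ℝ) * D.len n c with hK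
  have hσ : (0 : ℝ) < W.noiseE := W.noiseE_pos
  let H : (Fin n → ℝ≥0 × ℝ≥0) → Fin n → ℝ := fun h k =>
    (h k).2 * D.symbol (fun c => (x c).1) h k
  let w : ℝ≥0 × ℝ≥0 → ℝ≥0 := fun p => W.noiseE + D.peak p + s * D.peak p
  let m' : (Fin n → ℝ≥0 × ℝ≥0) → Fin n → ℝ := fun h k =>
    (1 + s) * H h k * (W.noiseE + D.peak (h k)) / w (h k)
  let v' : (Fin n → ℝ≥0 × ℝ≥0) → Fin n → ℝ≥0 := fun h k =>
    W.noiseE * (W.noiseE + D.peak (h k)) / w (h k)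
  -- An upper bound for the tilted density off the typical set. For fixed gains its Gaussian factor
  -- integrates to one in `z`, whatever the means, so the time-dependent means `m'` disappear and an
  -- i.i.d. product over the gains remains.
  let F : (Fin n → ℝ) × (Fin n → ℝ≥0 × ℝ≥0) → ℝ≥0∞ := fun zh =>
    (ENNReal.ofReal (Real.exp K) * ∏ k, ENNReal.ofReal (Real.exp (s * D.gainExponent s (zh.2 k))))
      * ∏ k, gaussianPDF (m' zh.2 k) (v' zh.2 k) (zh.1 k)
  have hw : ∀ p, 0 < w p := fun p =>
    add_pos_of_pos_of_nonneg (add_pos_of_pos_of_nonneg W.noiseE_pos zero_le) zero_le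
  have hv' : ∀ h k, v' h k ≠ 0 := fun h k =>
    (div_pos (mul_pos W.noiseE_pos (add_pos_of_pos_of_nonneg W.noiseE_pos zero_le)) (hw _)).ne'
  have hexp : Measurable fun p => ENNReal.ofReal (Real.exp (s * D.gainExponent s p)) :=
    ((D.measurable_gainExponent s).const_mul _).exp.ennreal_ofReal
  have hFm : Measurable F := by
    have hk : ∀ k : Fin n, Measurable fun zh : (Fin n → ℝ) × (Fin n → ℝ≥0 × ℝ≥0) => zh.2 k :=
      fun k => (measurable_pi_apply k).comp measurable_snd
    have hpk := fun k => D.measurable_peak.comp (hk k)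
    have hwk : ∀ k, Measurable fun zh : (Fin n → ℝ) × (Fin n → ℝ≥0 × ℝ≥0) => w (zh.2 k) :=
      fun k => ((measurable_const.add (hpk k)).add ((hpk k).const_mul s))
    refine (measurable_const.mul (Finset.measurable_prod _ fun k _ => hexp.comp (hk k))).mul
      (Finset.measurable_prod _ fun k _ => measurable_gaussianPDF_comp ?_ ?_
        ((measurable_pi_apply k).comp measurable_fst))
    · refine Measurable.div (Measurable.mul (Measurable.const_mul (Measurable.mul ?_ ?_) _) ?_)
        (measurable_subtype_coe.comp (hwk k))
      · exact measurable_subtype_coe.comp (measurable_snd.comp (hk k))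
      · exact (D.measurable_symbol _ k).comp measurable_snd
      · exact measurable_const.add (measurable_subtype_coe.comp (hpk k))
    · exact ((measurable_const.add (hpk k)).const_mul _).div (hwk k)
  have hFint : ∫⁻ zh, F zh ∂(W.refMeasure n)
      = ENNReal.ofReal (Real.exp K * (∫ h, Real.exp (s * D.gainExponent s h) ∂W.gainLaw) ^ n) := by
    rw [lintegral_refMeasure hFm]
    have h1 : ∀ h : Fin n → ℝ≥0 × ℝ≥0, ∫⁻ z, F (z, h) = ENNReal.ofReal (Real.exp K)
        * ∏ k, ENNReal.ofReal (Real.exp (s * D.gainExponent s (h k))) := by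
      intro h
      simp only [F]
      rw [lintegral_const_mul' _ _ (ENNReal.mul_ne_top ENNReal.ofReal_ne_top
          (ENNReal.prod_ne_top fun _ _ => ENNReal.ofReal_ne_top)),
        lintegral_prod_gaussianPDF _ (hv' h), mul_one]
    simp_rw [h1]
    rw [lintegral_const_mul' _ _ ENNReal.ofReal_ne_top,
      lintegral_pi_prod_ofReal (f := fun _ p => Real.exp (s * D.gainExponent s p))
        (fun _ _ => (Real.exp_pos _).le) fun _ => D.integrable_exp_gainExponent s,
      ENNReal.ofReal_mul (Real.exp_pos _).le, Finset.prod_const, Finset.card_univ, Fintype.card_fin,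
      ENNReal.ofReal_pow (integral_nonneg fun _ => (Real.exp_pos _).le)]
  rw [← hFint]
  refine (setLIntegral_mono hFm fun zh hzh => ?_).trans (setLIntegral_le_lintegral _ _)
  obtain ⟨z, h⟩ := zh
  let g : Fin n → ℝ := fun k => gaussianPDFReal (H h k) W.noiseE (z k)
  let q : Fin n → ℝ := fun k => gaussianPDFReal 0 (W.noiseE + D.peak (h k)) (z k)
  have hg : ∀ k, 0 < g k := fun k => gaussianPDFReal_pos _ _ _ W.noiseE_pos.ne'
  have hq : ∀ k, 0 < q k := fun k =>
    gaussianPDFReal_pos _ _ _ (add_pos_of_pos_of_nonneg W.noiseE_pos zero_le).ne'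
  have hG : D.eveDensity C x (z, h) = ENNReal.ofReal (∏ k, g k) :=
    (ENNReal.ofReal_prod_of_nonneg fun k _ => (hg k).le).symm
  have hQ : D.refDensity (z, h) = ENNReal.ofReal (∏ k, q k) :=
    (ENNReal.ofReal_prod_of_nonneg fun k _ => (hq k).le).symm
  have hlt : Real.exp t * ∏ k, q k < ∏ k, g k := by
    by_contra hle
    refine hzh ?_
    rw [Set.mem_ofPred_eq, hG, hQ, ← ENNReal.ofReal_mul (Real.exp_pos t).le]
    exact ENNReal.ofReal_le_ofReal (not_lt.mp hle)
  have hF : F (z, h) = ENNReal.ofReal (Real.exp (K + ∑ k, s * D.gainExponent s (h k))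
      * ∏ k, gaussianPDFReal (m' h k) (v' h k) (z k)) := by
    rw [ENNReal.ofReal_mul (Real.exp_pos _).le, Real.exp_add, ENNReal.ofReal_mul (Real.exp_pos _).le,
      Real.exp_sum, ENNReal.ofReal_prod_of_nonneg fun k _ => (Real.exp_pos _).le,
      ENNReal.ofReal_prod_of_nonneg fun k _ => gaussianPDFReal_nonneg _ _ _]
    rfl
  rw [hG, hF]
  refine ENNReal.ofReal_le_ofReal ((prod_le_of_exp_mul_prod_lt hg hq s.2 hlt).trans ?_)
  simp only [g, q, NNReal.val_eq_coe, gaussianPDFReal_mul_rpow_div W.noiseE_pos]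
  rw [Finset.prod_mul_distrib, ← Real.exp_sum, ← mul_assoc, ← Real.exp_add]
  refine mul_le_mul_of_nonneg_right (Real.exp_le_exp.mpr ?_)
    (Finset.prod_nonneg fun k _ => gaussianPDFReal_nonneg _ _ _)
  have hsum := D.sum_received_sq_le C x s h
  have hterm : ∀ k, s / 2 * Real.log (1 + D.peak (h k) / W.noiseE)
      - 1 / 2 * Real.log (1 + s * D.peak (h k) / (W.noiseE + D.peak (h k)))
      + s * (1 + s) * H h k ^ 2 / (2 * (W.noiseE + D.peak (h k) + s * D.peak (h k)))
      ≤ s * D.gainExponent s (h k)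
        + s * (1 + s) / 2 * (H h k ^ 2 / (W.noiseE + D.peak (h k) + s * D.peak (h k))) := by
    intro k
    -- The bound `1 - 1/x ≤ log x` turns the second normalising logarithm into exactly `s * ratio`,
    -- the form needed to cancel the signal term.
    have hlog := Real.one_sub_inv_le_log_of_pos
      (x := 1 + s * D.peak (h k) / (W.noiseE + D.peak (h k))) (by positivity)
    have hr : 1 - (1 + s * D.peak (h k) / (W.noiseE + D.peak (h k)) : ℝ)⁻¹
        = s * D.ratio s (h k) := by
      rw [ratio_eq]
      push_cast
      field_simp
      ring
    rw [gainExponent]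
    have : (s * (1 + s) * H h k ^ 2 / (2 * (W.noiseE + D.peak (h k) + s * D.peak (h k))) : ℝ)
      = s * (1 + s) / 2 * (H h k ^ 2 / (W.noiseE + D.peak (h k) + s * D.peak (h k))) := by
      field_simp
    rw [this]
    linarith
  have hsum' := mul_le_mul_of_nonneg_left hsum (show (0 : ℝ) ≤ s * (1 + s) / 2 by positivity)
  rw [Finset.mul_sum] at hsum'
  have := (Finset.sum_le_sum fun k (_ : k ∈ Finset.univ) => hterm k).trans_eq Finset.sum_add_distrib
  rw [hK]
  linarith

end Demultiplexing

/-! ### The rate for a fixed demultiplexing -/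

namespace Demultiplexing

variable {W : FadingWiretapChannel} {P : ℝ} {d : ℕ}

/-- The capacity, in nats, of the channel with the largest received signal powers. -/
noncomputable def peakRate (D : Demultiplexing W P d) : ℝ :=
  1 / 2 * ∫ h, Real.log (1 + D.peak h / W.noiseE) ∂W.gainLaw

lemma integrable_log_peak (D : Demultiplexing W P d) :
    Integrable (fun h => Real.log (1 + D.peak h / W.noiseE)) W.gainLaw := by
  have h := ((D.integrable_gainExponent 0).const_mul 2).add
    (D.integrable_onCells (D.cellRatio 0) W.gainLaw)
  refine h.congr (ae_of_all _ fun p => ?_)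
  simp only [Pi.add_apply, gainExponent, ratio]
  ring

lemma integral_gainExponent (D : Demultiplexing W P d) (s : ℝ≥0) :
    ∫ h, D.gainExponent s h ∂W.gainLaw
      = D.peakRate - 1 / 2 * ∫ h, (D.ratio s h : ℝ) ∂W.gainLaw := by
  simp only [gainExponent, peakRate, ratio]
  rw [integral_sub (D.integrable_log_peak.const_mul _)
    ((D.integrable_onCells (D.cellRatio s) W.gainLaw).const_mul _), integral_const_mul,
    integral_const_mul]

/-- For `|y| ≤ 1` one has `exp y ≤ 1 + y + y²`; integrate this and use `1 + y ≤ exp y`. To first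
order in `s` only the mean of `f` matters. -/
lemma integral_exp_mul_le {Ω : Type*} [MeasurableSpace Ω] {μ : Measure Ω} [IsProbabilityMeasure μ]
    {f : Ω → ℝ} (hf : Measurable f) {K s : ℝ} (hK : ∀ x, |f x| ≤ K) (hs : 0 ≤ s) (hsK : s * K ≤ 1) :
    ∫ x, Real.exp (s * f x) ∂μ ≤ Real.exp (s * ∫ x, f x ∂μ + s ^ 2 * K ^ 2) := by
  have hfi : Integrable f μ := Integrable.of_bound hf.aestronglyMeasurable K (ae_of_all _ hK)
  have hint : Integrable (fun x => s * f x + (1 + s ^ 2 * K ^ 2)) μ :=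
    (hfi.const_mul s).add (integrable_const _)
  have hle : ∀ x, Real.exp (s * f x) ≤ s * f x + (1 + s ^ 2 * K ^ 2) := by
    intro x
    have habs : |s * f x| ≤ s * K := by
      rw [abs_mul, abs_of_nonneg hs]
      exact mul_le_mul_of_nonneg_left (hK x) hs
    have h1 := (abs_le.mp (Real.abs_exp_sub_one_sub_id_le (habs.trans hsK))).2
    have h2 : (s * f x) ^ 2 ≤ (s * K) ^ 2 := sq_le_sq.mpr (habs.trans (le_abs_self _))
    nlinarith
  calc ∫ x, Real.exp (s * f x) ∂μ ≤ ∫ x, s * f x + (1 + s ^ 2 * K ^ 2) ∂μ :=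
        integral_mono_of_nonneg (ae_of_all _ fun _ => (Real.exp_pos _).le) hint (ae_of_all _ hle)
    _ = (s * ∫ x, f x ∂μ + s ^ 2 * K ^ 2) + 1 := by
        rw [integral_add (hfi.const_mul s) (integrable_const _), integral_const_mul]
        simp
        ring
    _ ≤ _ := Real.add_one_le_exp _

/-- With length `p_c n` in each cell the sum would be exactly `n` times the mean of `ratio`; the
finitely many `o(n)` deviations cost at most `δ n`. -/
lemma eventually_sum_cellRatio_mul_len_le (D : Demultiplexing W P d) (s : ℝ≥0) {δ : ℝ}
    (hδ : 0 < δ) :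
    ∀ᶠ n : ℕ in atTop, ∑ c, (D.cellRatio s c : ℝ) * D.len n c
      ≤ n * (∫ h, (D.ratio s h : ℝ) ∂W.gainLaw + δ) := by
  have ho := IsLittleO.sum (s := Finset.univ) fun c _ =>
    (D.len_isLittleO c).const_mul_left (D.cellRatio s c : ℝ)
  filter_upwards [ho.def hδ] with n hn
  have h1 := (abs_le.mp hn).1
  rw [Real.norm_natCast] at h1
  rw [Finset.sum_apply] at h1
  simp only [mul_sub, Finset.sum_sub_distrib] at h1
  have h2 : ∑ c, (D.cellRatio s c : ℝ) * (W.gainLaw.real (gridCell D.endT D.endE c) * n)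
      = n * ∫ h, (D.ratio s h : ℝ) ∂W.gainLaw := by
    rw [ratio, integral_onCells, Finset.mul_sum]
    exact Finset.sum_congr rfl fun c _ => by rw [cell]; ring
  rw [h2] at h1
  linarith

/-- For long blocks the smooth max-information per channel use is at most slightly more than
`peakRate`, with an exponentially small smoothing parameter. -/
lemma exists_eventually_eveMaxInfo_le (D : Demultiplexing W P d) {η : ℝ} (hη : 0 < η) :
    ∃ a : ℝ, 0 < a ∧ ∀ᶠ n : ℕ in atTop, ∀ C : D.Codebooks n,
      D.eveMaxInfo C (Real.exp (-(a * (n : ℝ))))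
        ≤ ((n * (D.peakRate + η) / Real.log 2 : ℝ) : EReal) := by
  obtain ⟨K, hK1, hK⟩ := D.exists_abs_gainExponent_le
  -- `K` is uniform in `s`, so `s` may depend on it. The first bound allows the quadratic moment
  -- estimate; the second makes all second-order terms at most half of the gain `s η`.
  have hspos : 0 < min (1 / K) (η / (2 * (K ^ 2 + 2))) := by positivity
  obtain ⟨s, hs⟩ : ∃ s : ℝ≥0, (s : ℝ) = min (1 / K) (η / (2 * (K ^ 2 + 2))) :=
    ⟨⟨_, hspos.le⟩, rfl⟩
  have hs0 : (0 : ℝ) < s := hs ▸ hspos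
  have hsK : s * K ≤ 1 := (le_div_iff₀ (by positivity)).mp (hs ▸ min_le_left _ _)
  have hsη : s * (2 * (K ^ 2 + 2)) ≤ η := (le_div_iff₀ (by positivity)).mp (hs ▸ min_le_right _ _)
  have hs1 : (s : ℝ) ≤ 1 := (le_mul_of_one_le_right hs0.le hK1).trans hsK
  refine ⟨s * η / 2, by positivity, ?_⟩
  -- The length deviation is allowed the slack `δ = s`, which again contributes only at order `s²`.
  filter_upwards [D.eventually_sum_cellRatio_mul_len_le s hs0] with n hn C
  set t : ℝ := n * (D.peakRate + η) with ht
  set R : ℝ := ∫ h, (D.ratio s h : ℝ) ∂W.gainLaw with hR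
  have hR1 : R ≤ 1 := by
    refine (integral_mono (D.integrable_onCells _ _) (integrable_const 1) fun h => ?_).trans_eq
      (by simp)
    exact_mod_cast D.ratio_le_one s h
  let T : Set (C.Input × ((Fin n → ℝ) × (Fin n → ℝ≥0 × ℝ≥0))) :=
    {p | D.eveDensity C p.1 p.2 ≤ ENNReal.ofReal (Real.exp t) * D.refDensity p.2}
  have : Nonempty C.Input :=
    ⟨fun c => ⟨(C.words_nonempty c).choose, (C.words_nonempty c).choose_spec⟩⟩
  refine smoothMaxInfo_le (T := T) (isTypical_of_compl (Real.exp_pos _).le (fun x => ?_)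
    (D.lintegral_eveDensity C) fun x => ?_) D.refDensity (fun x zh h => h)
    (D.lintegral_refDensity n).le
  · exact measurableSet_le (D.measurable_eveDensity C x) (D.measurable_refDensity.const_mul _)
  · refine (D.setLIntegral_eveDensity_le C x s t).trans (ENNReal.ofReal_le_ofReal ?_)
    have hmom := integral_exp_mul_le (μ := W.gainLaw) (D.measurable_gainExponent s) (hK s) hs0.le hsK
    rw [integral_gainExponent, ← hR] at hmom
    have hpow := pow_le_pow_left₀ (integral_nonneg fun _ => (Real.exp_pos _).le) hmom n
    rw [← Real.exp_nat_mul] at hpow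
    refine (mul_le_mul_of_nonneg_left hpow (Real.exp_pos _).le).trans ?_
    rw [← Real.exp_add]
    refine Real.exp_le_exp.mpr ?_
    have h1 := mul_le_mul_of_nonneg_left hn (show (0 : ℝ) ≤ s * (1 + s) / 2 by positivity)
    -- After cancellation of `s * peakRate` and `s * R / 2`, these are the remaining positive terms
    -- of the exponent per channel use, against `-s η`.
    have h2 : (s : ℝ) ^ 2 * R / 2 + s ^ 2 * (1 + s) / 2 + s ^ 2 * K ^ 2 ≤ s * η / 2 := by
      nlinarith [mul_le_mul_of_nonneg_left hsη hs0.le, mul_le_mul_of_nonneg_left hR1 (sq_nonneg (s : ℝ)),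
        mul_le_mul_of_nonneg_left hs1 (sq_nonneg (s : ℝ))]
    have h3 := mul_le_mul_of_nonneg_left h2 (Nat.cast_nonneg (α := ℝ) n)
    rw [ht]
    linarith

end Demultiplexing

/-! ### Fine demultiplexings -/

/-- Apply `log y ≤ y - 1` to `y = r (1 + x)`. The slope is arbitrarily small at the price of the
constant `K`, which replaces uniform integrability of the powers. -/
lemma exists_log_one_add_le {r : ℝ} (hr : 0 < r) :
    ∃ K : ℝ, 0 ≤ K ∧ ∀ x : ℝ, 0 ≤ x → Real.log (1 + x) ≤ r * x + K := by
  refine ⟨r + |Real.log r|, by positivity, fun x hx => ?_⟩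
  have h1 := Real.log_le_sub_one_of_pos (x := r * (1 + x)) (by positivity)
  rw [Real.log_mul hr.ne' (by positivity)] at h1
  linarith [neg_abs_le (Real.log r)]

lemma log_one_add_le_self {x : ℝ} (hx : 0 ≤ x) : Real.log (1 + x) ≤ x := by
  linarith [Real.log_le_sub_one_of_pos (x := 1 + x) (by positivity)]

lemma log_le_log_add_log {x y z : ℝ} (hx : 0 ≤ x) (hy : 0 ≤ y) (hz : 0 ≤ z)
    (h : z ≤ x + y + x * y) : Real.log (1 + z) ≤ Real.log (1 + x) + Real.log (1 + y) := by
  rw [← Real.log_mul (by positivity) (by positivity)]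
  exact Real.log_le_log (by positivity) (by linarith)

/-- A perturbation bound for `log (1 + g u² / σ)` whose error terms are linear in the powers. -/
lemma log_one_add_perturb_le {r K σ g g' u e : ℝ} (hr : 0 < r) (hr1 : r ≤ 1) (hσ : 0 < σ)
    (hK0 : 0 ≤ K) (hK : ∀ x : ℝ, 0 ≤ x → Real.log (1 + x) ≤ r * x + K) (hg : 0 ≤ g) (hg' : 0 ≤ g')
    (hu : 0 ≤ u) (he0 : 0 ≤ e) (he : e ≤ g' * (u + r) ^ 2) {b : ℝ} (hb : 0 ≤ b)
    (hb1 : r ≤ |g' - g| → b = 1) :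
    Real.log (1 + e / σ) ≤ Real.log (1 + g * u ^ 2 / σ)
      + (r + r * (g / σ) + 2 * r * ((u + 1) ^ 2 / σ) + r * g' + 2 * K * b) := by
  set Y := (u + r) ^ 2 / σ with hY
  have hY0 : 0 ≤ Y := by positivity
  have hY1 : Y ≤ (u + 1) ^ 2 / σ := by rw [hY]; gcongr
  have hle : Real.log (1 + e / σ) ≤ Real.log (1 + g' * Y) := by
    refine Real.log_le_log (by positivity) ?_
    have := div_le_div_of_nonneg_right he hσ.le
    rw [mul_div_assoc] at this
    linarith
  have hrY := mul_le_mul_of_nonneg_left hY1 hr.le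
  have hlog0 : 0 ≤ Real.log (1 + g * u ^ 2 / σ) :=
    Real.log_nonneg (le_add_of_nonneg_right (by positivity))
  have hgσ : 0 ≤ r * (g / σ) := by positivity
  have hg'r : 0 ≤ r * g' := by positivity
  have hrY0 : 0 ≤ r * Y := by positivity
  have hKb : 0 ≤ 2 * K * b := by positivity
  refine hle.trans ?_
  rcases lt_or_ge |g' - g| r with h | h
  -- Powers close: replace `g'` by `g + r`, then split off the shift of the gain using `(u + r)² ≤
  -- (1 + r)(u² + r)`.
  · have h1 : Real.log (1 + g' * Y) ≤ Real.log (1 + g * Y) + Real.log (1 + r * Y) := by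
      refine log_le_log_add_log (by positivity) (by positivity) (by positivity) ?_
      have := mul_le_mul_of_nonneg_right (sub_le_iff_le_add.mp (abs_lt.mp h).2.le) hY0
      nlinarith [mul_nonneg (mul_nonneg hg hY0) hrY0]
    have h2 : Real.log (1 + g * Y)
        ≤ Real.log (1 + r) + Real.log (1 + (g * u ^ 2 / σ + r * (g / σ))) := by
      refine log_le_log_add_log hr.le (by positivity) (by positivity) ?_
      have : g * Y ≤ (1 + r) * (g * u ^ 2 / σ + r * (g / σ)) := by
        have hsq : (u + r) ^ 2 ≤ (1 + r) * (u ^ 2 + r) := by nlinarith [mul_nonneg hr.le (sq_nonneg (1 - u))]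
        calc g * Y = g / σ * (u + r) ^ 2 := by rw [hY]; ring
          _ ≤ g / σ * ((1 + r) * (u ^ 2 + r)) := by gcongr
          _ = _ := by ring
      linarith
    have h3 : Real.log (1 + (g * u ^ 2 / σ + r * (g / σ)))
        ≤ Real.log (1 + g * u ^ 2 / σ) + Real.log (1 + r * (g / σ)) :=
      log_le_log_add_log (by positivity) hgσ (by positivity)
        (le_add_of_nonneg_right (by positivity))
    linarith [log_one_add_le_self hr.le, log_one_add_le_self hgσ, log_one_add_le_self hrY0]
  -- Powers far apart: discard the capacity term and use sublinear growth; the constant `2 * K` is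
  -- charged to `b`.
  · have h1 : Real.log (1 + g' * Y) ≤ Real.log (1 + g') + Real.log (1 + Y) :=
      log_le_log_add_log hg' hY0 (by positivity) (by linarith)
    rw [hb1 h]
    linarith [hK g' hg', hK Y hY0]

/-- Fatou's lemma along an almost everywhere convergent subsequence: the limit inherits the power
budget `P`. -/
lemma integrable_coe_of_tendstoInMeasure {Ω : Type*} [MeasurableSpace Ω] {μ : Measure Ω}
    {f : ℕ → Ω → ℝ≥0} {g : Ω → ℝ≥0} (hf : ∀ n, Measurable (f n)) (hg : Measurable g)
    (h : TendstoInMeasure μ f atTop g) {P : ℝ} (hfi : ∀ n, Integrable (fun x => (f n x : ℝ)) μ)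
    (hP : ∀ n, ∫ x, (f n x : ℝ) ∂μ ≤ P) : Integrable (fun x => (g x : ℝ)) μ := by
  obtain ⟨ns, -, hns⟩ := h.exists_seq_tendsto_ae
  refine ⟨hg.coe_nnreal_real.aestronglyMeasurable, ?_⟩
  have hlim : ∀ᵐ x ∂μ, (g x : ℝ≥0∞) = liminf (fun i => (f (ns i) x : ℝ≥0∞)) atTop :=
    hns.mono fun x hx => (ENNReal.tendsto_coe.mpr hx).liminf_eq.symm
  have hbound : ∀ n, ∫⁻ x, (f n x : ℝ≥0∞) ∂μ ≤ ENNReal.ofReal P := by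
    intro n
    have := ofReal_integral_eq_lintegral_ofReal (hfi n) (ae_of_all _ fun x => NNReal.coe_nonneg _)
    simp only [ENNReal.ofReal_coe_nnreal] at this
    exact this ▸ ENNReal.ofReal_le_ofReal (hP n)
  rw [hasFiniteIntegral_iff_ofReal (ae_of_all _ fun x => NNReal.coe_nonneg _)]
  simp only [ENNReal.ofReal_coe_nnreal]
  calc ∫⁻ x, (g x : ℝ≥0∞) ∂μ = ∫⁻ x, liminf (fun i => (f (ns i) x : ℝ≥0∞)) atTop ∂μ :=
        lintegral_congr_ae hlim
    _ ≤ liminf (fun i => ∫⁻ x, (f (ns i) x : ℝ≥0∞) ∂μ) atTop :=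
        lintegral_liminf_le fun i => (hf (ns i)).coe_nnreal_ennreal
    _ ≤ ENNReal.ofReal P := liminf_le_of_frequently_le' (Frequently.of_forall fun i => hbound _)
    _ < ⊤ := ENNReal.ofReal_lt_top

lemma FadingWiretapChannel.integrable_sq_gain (W : FadingWiretapChannel) :
    Integrable (fun h : ℝ≥0 × ℝ≥0 => (h.2 : ℝ) ^ 2) W.gainLaw :=
  W.integrable_sq_gainE.comp_snd W.lawT

lemma FadingWiretapChannel.integrable_add_one_sq_gain (W : FadingWiretapChannel) :
    Integrable (fun h : ℝ≥0 × ℝ≥0 => ((h.2 : ℝ) + 1) ^ 2 / W.noiseE) W.gainLaw := by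
  refine Integrable.div_const ?_ _
  refine ((W.integrable_sq_gain.const_mul 2).add (integrable_const 2)).mono' ?_
    (ae_of_all _ fun h => ?_)
  · exact Measurable.aestronglyMeasurable (by fun_prop)
  · rw [Real.norm_of_nonneg (by positivity)]
    simp only [Pi.add_apply]
    nlinarith [sq_nonneg ((h.2 : ℝ) - 1)]

/-- The product `γ H_E²` need not be integrable, but the logarithm separates its factors, and each
factor is. -/
lemma FadingWiretapChannel.integrable_log_snr (W : FadingWiretapChannel) {γ : ℝ≥0 × ℝ≥0 → ℝ≥0}
    (hγ : Measurable γ) (hγi : Integrable (fun h => (γ h : ℝ)) W.gainLaw) :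
    Integrable (fun h => Real.log (1 + (γ h : ℝ) * (h.2 : ℝ) ^ 2 / W.noiseE)) W.gainLaw := by
  refine (hγi.add (W.integrable_sq_gain.div_const (W.noiseE : ℝ))).mono' ?_ (ae_of_all _ fun h => ?_)
  · exact Measurable.aestronglyMeasurable (by fun_prop)
  · have h1 : 0 ≤ Real.log (1 + (γ h : ℝ) * (h.2 : ℝ) ^ 2 / W.noiseE) :=
      Real.log_nonneg (le_add_of_nonneg_right (by positivity))
    have h2 := log_le_log_add_log (x := (γ h : ℝ)) (y := (h.2 : ℝ) ^ 2 / W.noiseE)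
      (z := (γ h : ℝ) * (h.2 : ℝ) ^ 2 / W.noiseE) (by positivity) (by positivity) (by positivity)
      (by rw [mul_div_assoc]; exact le_add_of_nonneg_left (by positivity))
    rw [Real.norm_of_nonneg h1]
    exact h2.trans (add_le_add (log_one_add_le_self (by positivity))
      (log_one_add_le_self (by positivity)))

namespace Demultiplexing

/-- The gain is at least the left endpoint of its cell, so the right endpoint exceeds it by less
than `r`. -/
lemma peak_le {W : FadingWiretapChannel} {P : ℝ} {d : ℕ} (D : Demultiplexing W P d) {r : ℝ}
    (hr : ∀ j : Fin d, (D.endE j.succ : ℝ) - (D.endE j.castSucc : ℝ) < r) (h : ℝ≥0 × ℝ≥0) :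
    (D.peak h : ℝ) ≤ D.alloc h * ((h.2 : ℝ) + r) ^ 2 := by
  by_cases hc : ∃ c, h ∈ D.cell c
  · obtain ⟨c, hc⟩ := hc
    rw [alloc_eq_onCells, peak, D.onCells_of_mem _ hc, D.onCells_of_mem _ hc, cellPeak]
    have h1 : (D.endE c.2.castSucc : ℝ) ≤ h.2 := by exact_mod_cast hc.2.1
    have h2 := hr c.2
    push_cast
    gcongr
    linarith
  · push Not at hc
    rw [alloc_eq_onCells, peak, D.onCells_of_forall_notMem _ hc, D.onCells_of_forall_notMem _ hc]
    simp

/-- As the cells shrink, `peakRate` is asymptotically at most the capacity of the limiting power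
allocation. -/
lemma eventually_peakRate_le {W : FadingWiretapChannel} {P : ℝ} {γ : ℝ≥0 × ℝ≥0 → ℝ≥0}
    (hγ : Measurable γ) (D : ∀ d : ℕ, Demultiplexing W P d)
    (hmesh : ∀ r : ℝ, 0 < r → ∀ᶠ d in atTop, ∀ j : Fin d,
      ((D d).endE j.succ : ℝ) - ((D d).endE j.castSucc : ℝ) < r)
    (halloc : TendstoInMeasure W.gainLaw (fun d => (D d).alloc) atTop γ) {δ : ℝ} (hδ : 0 < δ) :
    ∀ᶠ d in atTop, 2 * (D d).peakRate
      ≤ ∫ h, Real.log (1 + (γ h : ℝ) * (h.2 : ℝ) ^ 2 / W.noiseE) ∂W.gainLaw + δ := by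
  have hσ : (0 : ℝ) < W.noiseE := W.noiseE_pos
  have hmeas : ∀ d, Measurable (D d).alloc := fun d => (D d).measurable_onCells _
  have hint : ∀ d, Integrable (fun h => ((D d).alloc h : ℝ)) W.gainLaw :=
    fun d => (D d).integrable_onCells _ _
  have hP : ∀ d, ∫ h, ((D d).alloc h : ℝ) ∂W.gainLaw ≤ P := fun d =>
    ((D d).integral_onCells _ _).trans_le (D d).power_le
  have hγi := integrable_coe_of_tendstoInMeasure hmeas hγ halloc hint hP
  set A := ∫ h, (γ h : ℝ) / W.noiseE ∂W.gainLaw with hA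
  set B := ∫ h : ℝ≥0 × ℝ≥0, ((h.2 : ℝ) + 1) ^ 2 / W.noiseE ∂W.gainLaw with hB
  have hA0 : 0 ≤ A := integral_nonneg fun _ => by positivity
  have hB0 : 0 ≤ B := integral_nonneg fun _ => by positivity
  have hP0 : 0 ≤ P := (integral_nonneg fun _ => NNReal.coe_nonneg _).trans (hP 0)
  -- The bracket collects the means of the error terms proportional to `r`. Then `K` is determined
  -- by `r`, and only afterwards is `d` taken so large that the bad event, weighted by `2 * K`,
  -- costs at most `δ / 2`.
  obtain ⟨r, hr0, hr1, hrδ⟩ : ∃ r : ℝ, 0 < r ∧ r ≤ 1 ∧ r * (1 + A + 2 * B + P) ≤ δ / 2 := by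
    refine ⟨min 1 (δ / 2 / (1 + A + 2 * B + P)), by positivity, min_le_left _ _, ?_⟩
    exact (le_div_iff₀ (by positivity)).mp (min_le_right _ _)
  obtain ⟨K, hK0, hK⟩ := exists_log_one_add_le hr0
  have hsmall : ∀ᶠ d in atTop,
      W.gainLaw.real {h | r ≤ dist ((D d).alloc h) (γ h)} < δ / (4 * (K + 1)) := by
    have hlim := (ENNReal.tendsto_toReal ENNReal.zero_ne_top).comp
      (tendstoInMeasure_iff_dist.mp halloc r hr0)
    exact hlim.eventually_lt_const (by simpa using (by positivity : 0 < δ / (4 * (K + 1))))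
  filter_upwards [hsmall, hmesh r hr0] with d hd hmd
  set S : Set (ℝ≥0 × ℝ≥0) := {h | r ≤ dist ((D d).alloc h) (γ h)} with hS
  have hSm : MeasurableSet S := measurableSet_le measurable_const ((hmeas d).dist hγ)
  have hSi : Integrable (S.indicator fun _ => (1 : ℝ)) W.gainLaw :=
    (integrable_const 1).indicator hSm
  have hpt : ∀ h, Real.log (1 + (D d).peak h / W.noiseE)
      ≤ Real.log (1 + (γ h : ℝ) * (h.2 : ℝ) ^ 2 / W.noiseE)
        + (r + r * ((γ h : ℝ) / W.noiseE) + 2 * r * (((h.2 : ℝ) + 1) ^ 2 / W.noiseE)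
          + r * (D d).alloc h + 2 * K * S.indicator (fun _ => (1 : ℝ)) h) := fun h =>
    log_one_add_perturb_le hr0 hr1 hσ hK0 hK (NNReal.coe_nonneg _) (NNReal.coe_nonneg _)
      (NNReal.coe_nonneg _) (NNReal.coe_nonneg _) ((D d).peak_le hmd h)
      (Set.indicator_nonneg (fun _ _ => zero_le_one) h)
      fun hh => Set.indicator_of_mem (show h ∈ S from hh) _
  have i0 := W.integrable_log_snr hγ hγi
  have i1 : Integrable (fun _ : ℝ≥0 × ℝ≥0 => r) W.gainLaw := integrable_const r
  have i2 := (hγi.div_const (W.noiseE : ℝ)).const_mul r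
  have i3 := W.integrable_add_one_sq_gain.const_mul (2 * r)
  have i4 := (hint d).const_mul r
  have i5 := hSi.const_mul (2 * K)
  have hI := integral_mono (D d).integrable_log_peak
    (i0.add ((((i1.add i2).add i3).add i4).add i5)) hpt
  rw [integral_add' i0 ((((i1.add i2).add i3).add i4).add i5),
    integral_add' (((i1.add i2).add i3).add i4) i5, integral_add' ((i1.add i2).add i3) i4,
    integral_add' (i1.add i2) i3, integral_add' i1 i2] at hI
  simp only [integral_const_mul, integral_indicator_const _ hSm, integral_const, probReal_univ,
    smul_eq_mul, mul_one] at hI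
  have h4 := mul_le_mul_of_nonneg_left (hP d) hr0.le
  have h5 : 2 * K * W.gainLaw.real S ≤ δ / 2 := by
    have := (lt_div_iff₀ (by positivity)).mp hd
    nlinarith [measureReal_nonneg (μ := W.gainLaw) (s := S)]
  rw [peakRate]
  linarith

end Demultiplexing

theorem mainTheorem9 (W : FadingWiretapChannel) (P : ℝ)
    (γ : ℝ≥0 × ℝ≥0 → ℝ≥0) (hγ : Measurable γ)
    (D : ∀ d : ℕ, Demultiplexing W P d)
    (hmeshT : ∀ r : ℝ, 0 < r → ∀ᶠ d in atTop, ∀ i : Fin d,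
      ((D d).endT i.succ : ℝ) - ((D d).endT i.castSucc : ℝ) < r)
    (hmeshE : ∀ r : ℝ, 0 < r → ∀ᶠ d in atTop, ∀ j : Fin d,
      ((D d).endE j.succ : ℝ) - ((D d).endE j.castSucc : ℝ) < r)
    (hcover : Tendsto (fun d => W.gainLaw (⋃ c, (D d).cell c)ᶜ) atTop (𝓝 0))
    (halloc : TendstoInMeasure W.gainLaw (fun d => (D d).alloc) atTop γ) :
    ∀ η : ℝ, 0 < η → ∀ᶠ d in atTop, ∃ a : ℝ, 0 < a ∧
      ∀ C : ∀ n : ℕ, (D d).Codebooks n,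
        limsup (fun n : ℕ => (D d).eveMaxInfo (C n) (Real.exp (-(a * (n : ℝ)))) / ((n : ℝ) : EReal))
            atTop
          ≤ ((1 / 2 * ∫ h, Real.logb 2 (1 + (γ h : ℝ) * (h.2 : ℝ) ^ 2 / (W.noiseE : ℝ)) ∂W.gainLaw
              + η : ℝ) : EReal) := by
  intro η hη
  have hlog2 : 0 < Real.log 2 := Real.log_pos one_lt_two
  -- In nats, `η * log 2` is split in half: one half for passing from `peakRate` to the capacity for
  -- `γ`, the other for the typical set.
  filter_upwards [Demultiplexing.eventually_peakRate_le hγ D hmeshE halloc (mul_pos hη hlog2)]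
    with d hd
  obtain ⟨a, ha, hev⟩ := (D d).exists_eventually_eveMaxInfo_le
    (η := η * Real.log 2 / 2) (by positivity)
  refine ⟨a, ha, fun C => limsup_le_of_le (by isBoundedDefault) ?_⟩
  filter_upwards [hev, eventually_gt_atTop 0] with n hn hn0
  have hn0' : (0 : ℝ) < n := by exact_mod_cast hn0
  refine (EReal.div_le_div_right_of_nonneg (by exact_mod_cast hn0'.le) (hn (C n))).trans ?_
  rw [← EReal.coe_div, EReal.coe_le_coe_iff]
  simp only [Real.logb]
  rw [integral_div, mul_div_assoc, mul_div_cancel_left₀ _ hn0'.ne', div_le_iff₀ hlog2]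
  have : (∫ h, Real.log (1 + (γ h : ℝ) * (h.2 : ℝ) ^ 2 / (W.noiseE : ℝ)) ∂W.gainLaw) / Real.log 2
      * Real.log 2 = ∫ h, Real.log (1 + (γ h : ℝ) * (h.2 : ℝ) ^ 2 / (W.noiseE : ℝ)) ∂W.gainLaw :=
    div_mul_cancel₀ _ hlog2.ne'
  nlinarith
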